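/- Let $X$ be a complex Banach space with open unit ball $\mathbb{B}$, let $\mathbb{U}\subset\mathbb{C}$ be the open unit disk, and for $z\in X\setminus\{0\}$ let $T_z$ be the set of continuous linear functionals $l_z:X\to\mathbb{C}$ with $l_z(z)=\|z\|$ and $\|l_z\|=1$. Let $\Phi:\mathbb{U}\to\mathbb{C}$ be biholomorphic onto its image with $\Phi(0)=1$, $\operatorname{Re}\Phi>0$ on $\mathbb{U}$, $\Phi'(0)>0$ and $\Phi''(0)\in\mathbb{R}$, and let $\mathcal{M}_\Phi$ be the class of holomorphic mappings $p:\mathbb{B}\to X$ with $p(0)=0$, $Dp(0)=I$ and $\|z\|/l_z(p(z))\in\Phi(\mathbb{U})$ for all $z\in\mathbb{B}\setminus\{0\}$ and all $l_z\in T_z$. Suppose that $$|\Phi''(0)+2(\Phi'(0))^2|\ge 2\Phi'(0).$$ Call a holomorphic function $g:\mathbb{B}\to\mathbb{C}$ admissible if $g(0)=1$ and the mapping $G(z)=z\,g(z)$ has invertible derivative $DG(z)$ at every $z\in\mathbb{B}$ and satisfies $(DG(z))^{-1}G(z)\in\mathcal{M}_\Phi$. For $z\in\mathbb{B}\setminus\{0\}$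 and $l_z\in T_z$ put $$b_2=\frac{l_z(D^2G(0)(z^2))}{2!\,\|z\|^2},\qquad b_3=\frac{l_z(D^3G(0)(z^3))}{3!\,\|z\|^3}.$$ Then for every admissible $g$, every $z\in\mathbb{B}\setminus\{0\}$ and every $l_z\in T_z$, $$|b_2^2-b_3^2|\le\frac{(\Phi'(0))^2}{4}\left(\frac12\,\frac{\Phi''(0)}{\Phi'(0)}+\Phi'(0)\right)^2+(\Phi'(0))^2 .$$ The bound is sharp: for every $u\in X$ with $\|u\|=1$ there is an admissible $g$ for which equality holds for all $z=ru$, $0<r<1$, and all $l_z\in T_z$. -/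

import Mathlib

namespace Toeplitz

open Metric Set

noncomputable section

/-- Holomorphic mappings on a set `Ω` of a complex Banach space: near every point of `Ω` the
mapping is the sum of its power series of bounded multilinear mappings. -/
def Holo {E F : Type*} [NormedAddCommGroup E] [NormedSpace ℂ E]
    [NormedAddCommGroup F] [NormedSpace ℂ F] (f : E → F) (Ω : Set E) : Prop :=
  AnalyticOnNhd ℂ f Ω

/-- `f` is biholomorphic on `Ω`: it is holomorphic on `Ω`, its image is a domain, and it has an
inverse that is holomorphic on the image. -/
def Biholo {E F : Type*} [NormedAddCommGroup E] [NormedSpace ℂ E]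
    [NormedAddCommGroup F] [NormedSpace ℂ F] (f : E → F) (Ω : Set E) : Prop :=
  Holo f Ω ∧ IsOpen (f '' Ω) ∧ IsConnected (f '' Ω) ∧
    ∃ h : F → E, Holo h (f '' Ω) ∧ ∀ z ∈ Ω, h (f z) = z

/-- The standing requirements on `Φ`: biholomorphic on the unit disk, `Φ 0 = 1`, positive real
part on the disk, `Φ' 0` real and positive, `Φ'' 0` real. -/
structure IsPhi (Φ : ℂ → ℂ) : Prop where
  biholo : Biholo Φ (ball (0 : ℂ) 1)
  map_zero : Φ 0 = 1
  re_pos : ∀ ζ ∈ ball (0 : ℂ) 1, 0 < (Φ ζ).re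
  deriv_im : (deriv Φ 0).im = 0
  deriv_pos : 0 < (deriv Φ 0).re
  deriv2_im : (iteratedDeriv 2 Φ 0).im = 0

/-- The real number `Φ' 0`. -/
def d1 (Φ : ℂ → ℂ) : ℝ := (deriv Φ 0).re

/-- The real number `Φ'' 0`. -/
def d2 (Φ : ℂ → ℂ) : ℝ := (iteratedDeriv 2 Φ 0).re

variable {X : Type*} [NormedAddCommGroup X] [NormedSpace ℂ X]

/-- The set `T_z` of support functionals at `z` (used for `z ≠ 0`). -/
def supportFunctionals (z : X) : Set (X →L[ℂ] ℂ) :=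
  {l | l z = (‖z‖ : ℂ) ∧ ‖l‖ = 1}

/-- The class `M_Φ` of mappings on the unit ball of `X`. If `l (p z) = 0`, the quotient below is
`0` in Lean, which is not a value of `Φ` when `Φ` has positive real part. -/
def classM (X : Type*) [NormedAddCommGroup X] [NormedSpace ℂ X] (Φ : ℂ → ℂ) : Set (X → X) :=
  {p | Holo p (ball (0 : X) 1) ∧ p 0 = 0 ∧ fderiv ℂ p 0 = ContinuousLinearMap.id ℂ X ∧
    ∀ z ∈ ball (0 : X) 1 \ {0}, ∀ l ∈ supportFunctionals z,
      (‖z‖ : ℂ) / l (p z) ∈ Φ '' ball (0 : ℂ) 1}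

/-- The mapping `G z = z g(z)`. -/
def mulSelf (g : X → ℂ) : X → X := fun z => g z • z

/-- `g` is holomorphic on the unit ball, `g 0 = 1`, and `G z = z g(z)` is locally biholomorphic
with `(DG)⁻¹ G ∈ M_Φ`. -/
structure IsGenerator (Φ : ℂ → ℂ) (g : X → ℂ) : Prop where
  holo : Holo g (ball (0 : X) 1)
  map_zero : g 0 = 1
  invertible : ∀ z ∈ ball (0 : X) 1, (fderiv ℂ (mulSelf g) z).IsInvertible
  mem_classM : (fun z => (fderiv ℂ (mulSelf g) z).inverse (mulSelf g z)) ∈ classM X Φ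

/-- The quantity `l (D^k G(0)(z^k)) / (k! ‖z‖^k)`. -/
def coeff (k : ℕ) (G : X → X) (l : X →L[ℂ] ℂ) (z : X) : ℂ :=
  l (iteratedFDeriv ℂ k G 0 (fun _ => z)) / ((k.factorial : ℂ) * (‖z‖ : ℂ) ^ k)

end

end Toeplitz

/-!
The problem reduces to one complex variable. For a unit vector `u`, put `h(ζ) = g(ζ u)`. Since
`DG(z) v = g(z) v + (Dg(z) v) z`, the vector `(DG(z))⁻¹ G(z)` is a multiple of `z`, and membership
in `M_Φ` says that `1 + ζ h'(ζ) / h(ζ)` takes its values in `Φ(𝕌)` (`IsGenerator.exists_eq`). As `Φ`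
is biholomorphic, this function equals `Φ ∘ ω` for a Schwarz function `ω = c₁ ζ + c₂ ζ² + ⋯`.

With `B = Φ'(0)` and `C = Φ''(0)`, comparison of Taylor coefficients (`taylor_of_subordinate`) and
`coeff_succ_mulSelf` give `b₂ = h'(0) = B c₁` and
`b₃ = h''(0) / 2 = ((B² + C / 2) c₁² + B c₂) / 2`. The Schwarz–Pick inequality yields
`|c₂| ≤ 1 - |c₁|²`. Under the hypothesis `|B² + C / 2| ≥ B` the resulting bounds for `|b₂|` and
`|b₃|` are nondecreasing in `|c₁|`, and at `|c₁| = 1` their squares add up to the asserted bound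
(`norm_sq_sub_sq_le`).

For sharpness take `ω(ζ) = i ζ`, solve `ζ h' / h = Φ(i ζ) - 1` on the disk by an exponential of a
primitive, and put `g = h ∘ m` with `m` a support functional of `u` supplied by Hahn–Banach. Then
`b₂² = -B²` while `b₃² ≥ 0`, so `|b₂² - b₃²| = |b₂|² + |b₃|²`
(`isGenerator_comp_functional`, `exists_isGenerator_eq`).
-/

namespace Toeplitz

open Metric Set Filter Topology

/-! ### Taylor coefficients of Schwarz functions and of their subordinates -/

/-- The Schwarz–Pick inequality at the origin, for maps into the closed disk. If `|φ 0| < 1`, it is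
the Schwarz lemma for `φ` followed by the disk automorphism that moves `φ 0` to `0`. -/
theorem norm_deriv_le_one_sub_sq {φ : ℂ → ℂ} (hd : DifferentiableOn ℂ φ (ball 0 1))
    (hφ : MapsTo φ (ball 0 1) (closedBall 0 1)) :
    ‖deriv φ 0‖ ≤ 1 - ‖φ 0‖ ^ 2 := by
  have h0 : (0 : ℂ) ∈ ball (0 : ℂ) 1 := mem_ball_self one_pos
  have hnhds : ball (0 : ℂ) 1 ∈ 𝓝 (0 : ℂ) := isOpen_ball.mem_nhds h0
  have hle : ∀ ζ ∈ ball (0 : ℂ) 1, ‖φ ζ‖ ≤ 1 := fun ζ hζ => by simpa using hφ hζ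
  rcases (hle 0 h0).lt_or_eq with hlt | heq
  · set a := φ 0 with ha
    have hnum : ∀ w : ℂ, ‖w‖ ≤ 1 → ‖w - a‖ ≤ ‖1 - starRingEnd ℂ a * w‖ := by
      intro w hw
      have key : ‖1 - starRingEnd ℂ a * w‖ ^ 2 - ‖w - a‖ ^ 2 = (1 - ‖a‖ ^ 2) * (1 - ‖w‖ ^ 2) := by
        simp only [← Complex.normSq_eq_norm_sq, Complex.normSq_apply, Complex.sub_re,
          Complex.sub_im, Complex.mul_re, Complex.mul_im, Complex.conj_re, Complex.conj_im,
          Complex.one_re, Complex.one_im]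
        ring
      have h1 : 0 ≤ (1 - ‖a‖ ^ 2) * (1 - ‖w‖ ^ 2) := by
        apply mul_nonneg <;> nlinarith [norm_nonneg a, norm_nonneg w]
      exact le_of_sq_le_sq (by linarith) (norm_nonneg _)
    have hden : ∀ w : ℂ, ‖w‖ ≤ 1 → 1 - starRingEnd ℂ a * w ≠ 0 := by
      intro w hw h
      have : ‖starRingEnd ℂ a * w‖ = 1 := by
        rw [← sub_eq_zero.mp h, norm_one]
      rw [norm_mul, RCLike.norm_conj] at this
      nlinarith [norm_nonneg a, norm_nonneg w]
    set ψ : ℂ → ℂ := fun ζ => (φ ζ - a) / (1 - starRingEnd ℂ a * φ ζ) with hψ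
    have hψ0 : ψ 0 = 0 := by simp [hψ, ← ha]
    have hψd : DifferentiableOn ℂ ψ (ball 0 1) :=
      (hd.sub_const a).div ((hd.const_mul _).const_sub 1) fun ζ hζ => hden _ (hle ζ hζ)
    have hψm : MapsTo ψ (ball 0 1) (closedBall (ψ 0) 1) := by
      intro ζ hζ
      rw [hψ0, mem_closedBall_zero_iff, norm_div]
      exact div_le_one_of_le₀ (hnum _ (hle ζ hζ)) (norm_nonneg _)
    have hb := Complex.norm_deriv_le_one_of_mapsTo_ball hψd hψm one_pos
    have hD : HasDerivAt φ (deriv φ 0) 0 := (hd.differentiableAt hnhds).hasDerivAt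
    have hψD := (hD.sub_const a).div ((hD.const_mul (starRingEnd ℂ a)).const_sub 1)
      (hden _ (hle 0 h0))
    have hreal : 1 - starRingEnd ℂ a * a = ((1 - ‖a‖ ^ 2 : ℝ) : ℂ) := by
      push_cast
      rw [mul_comm, Complex.mul_conj, Complex.normSq_eq_norm_sq]
      push_cast; rfl
    have hpos : 0 < 1 - ‖a‖ ^ 2 := by nlinarith [norm_nonneg a]
    have hval : deriv ψ 0 = deriv φ 0 / ((1 - ‖a‖ ^ 2 : ℝ) : ℂ) := by
      have hne : ((1 - ‖a‖ ^ 2 : ℝ) : ℂ) ≠ 0 := by exact_mod_cast hpos.ne'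
      have := hψD.deriv
      rw [← ha, sub_self, zero_mul, sub_zero, hreal] at this
      refine this.trans ?_
      field_simp
    rw [hval, norm_div, Complex.norm_real, Real.norm_of_nonneg hpos.le, div_le_one hpos] at hb
    exact hb
  -- If `|φ 0| = 1`, the maximum principle makes `φ` constant near `0`.
  · have hmax : IsLocalMax (norm ∘ φ) 0 := by
      filter_upwards [hnhds] with ζ hζ
      simpa [heq] using hle ζ hζ
    have hconst : ∀ᶠ ζ in 𝓝 (0 : ℂ), φ ζ = φ 0 :=
      Complex.eventually_eq_of_isLocalMax_norm
        (by filter_upwards [eventually_mem_nhds_iff.2 hnhds] using fun ζ hζ =>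
          hd.differentiableAt hζ)
        hmax
    have : deriv φ 0 = 0 := by
      rw [EventuallyEq.deriv_eq (show φ =ᶠ[𝓝 0] fun _ => φ 0 from hconst), deriv_const]
    simp [this, heq]

theorem iteratedDeriv_succ_id_mul {k : ℂ → ℂ} (n : ℕ) (hk : ContDiffAt ℂ (n + 1 : ℕ) k 0) :
    iteratedDeriv (n + 1) (fun ζ => ζ * k ζ) 0 = (n + 1) * iteratedDeriv n k 0 := by
  rw [iteratedDeriv_fun_mul (f := fun ζ => ζ) contDiffAt_id hk,
    Finset.sum_eq_single_of_mem 1 (by simp)]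
  · simp
  · intro i _ hi
    simp [iteratedDeriv_fun_id, hi]

/-- The bound `|c₂| ≤ 1 - |c₁|²` on the Taylor coefficients of a Schwarz function
`ω ζ = c₁ ζ + c₂ ζ² + ⋯`: the Schwarz–Pick inequality for `ω ζ / ζ`. -/
theorem norm_iteratedDeriv_two_le {ω : ℂ → ℂ} (hd : DifferentiableOn ℂ ω (ball 0 1))
    (hω : MapsTo ω (ball 0 1) (ball 0 1)) (h0 : ω 0 = 0) :
    ‖iteratedDeriv 2 ω 0‖ ≤ 2 * (1 - ‖deriv ω 0‖ ^ 2) := by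
  have hnhds : ball (0 : ℂ) 1 ∈ 𝓝 (0 : ℂ) := ball_mem_nhds _ one_pos
  have hφd : DifferentiableOn ℂ (dslope ω 0) (ball 0 1) :=
    (Complex.differentiableOn_dslope hnhds).2 hd
  have hφm : MapsTo (dslope ω 0) (ball 0 1) (closedBall 0 1) := by
    intro ζ hζ
    have := Complex.norm_dslope_le_div_of_mapsTo_ball (R₂ := 1) hd
      (fun w hw => ball_subset_closedBall (by simpa [h0] using hω hw)) hζ
    simpa using this
  have hfac : ω = fun ζ => ζ * dslope ω 0 ζ := by
    ext ζ
    have := sub_smul_dslope ω 0 ζ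
    simp only [sub_zero, smul_eq_mul, h0] at this
    exact this.symm
  have han : ContDiffAt ℂ 2 (dslope ω 0) 0 := (hφd.analyticAt hnhds).contDiffAt
  have h2 : iteratedDeriv 2 ω 0 = 2 * deriv (dslope ω 0) 0 := by
    conv_lhs => rw [hfac]
    rw [iteratedDeriv_succ_id_mul 1 han, iteratedDeriv_one]
    norm_num
  have := norm_deriv_le_one_sub_sq hφd hφm
  rw [dslope_same] at this
  rw [h2, norm_mul, Complex.norm_ofNat]
  linarith

/-- Comparison of the first two Taylor coefficients in `ζ h'(ζ) = h(ζ) (F ζ - 1)`. -/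
theorem iteratedDeriv_of_mul_deriv_eq {h F : ℂ → ℂ} (hh : AnalyticAt ℂ h 0)
    (hF : AnalyticAt ℂ F 0) (h0 : h 0 = 1)
    (heq : ∀ᶠ ζ in 𝓝 (0 : ℂ), ζ * deriv h ζ = h ζ * (F ζ - 1)) :
    deriv h 0 = deriv F 0 ∧
      iteratedDeriv 2 h 0 = deriv F 0 ^ 2 + iteratedDeriv 2 F 0 / 2 := by
  have hF0 : F 0 = 1 := by
    have := heq.self_of_nhds
    rw [h0, zero_mul, one_mul] at this
    exact (sub_eq_zero.mp this.symm)
  have hE : (fun ζ => ζ * deriv h ζ) =ᶠ[𝓝 0] fun ζ => h ζ * (F ζ - 1) := heq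
  have hF' : AnalyticAt ℂ (fun ζ => F ζ - 1) 0 := hF.sub analyticAt_const
  have hsub : ∀ n : ℕ, 0 < n → iteratedDeriv n (fun ζ => F ζ - 1) 0 = iteratedDeriv n F 0 := by
    intro n hn
    obtain ⟨m, rfl⟩ := Nat.exists_eq_succ_of_ne_zero hn.ne'
    rw [iteratedDeriv_succ', iteratedDeriv_succ']
    congr 1
    ext ζ
    exact deriv_sub_const (f := F) (x := ζ) 1
  have hlhs (n : ℕ) : iteratedDeriv n (fun ζ => ζ * deriv h ζ) 0
      = iteratedDeriv n (fun ζ => h ζ * (F ζ - 1)) 0 := hE.iteratedDeriv_eq n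
  have e1 := hlhs 1
  have e2 := hlhs 2
  rw [iteratedDeriv_succ_id_mul _ hh.deriv.contDiffAt,
    iteratedDeriv_fun_mul hh.contDiffAt hF'.contDiffAt] at e1 e2
  simp only [Finset.sum_range_succ, Finset.sum_range_zero, hsub 1 one_pos, hsub 2 two_pos] at e1 e2
  simp [iteratedDeriv_one, h0, hF0] at e1 e2
  have e3 : iteratedDeriv 2 h 0 = deriv (deriv h) 0 := by
    rw [iteratedDeriv_succ', iteratedDeriv_one]
  refine ⟨e1, ?_⟩
  rw [e3]
  rw [e1] at e2
  linear_combination e2 / 2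

/-- The diagonal of the `n`-th Fréchet derivative is the `n`-th derivative along a complex line; both
sides are `n!` times the diagonal of the `n`-th term of the power series. -/
theorem iteratedFDeriv_apply_line {E F : Type*} [NormedAddCommGroup E] [NormedSpace ℂ E]
    [NormedAddCommGroup F] [NormedSpace ℂ F] [CompleteSpace F] {G : E → F} (hG : AnalyticAt ℂ G 0)
    (u : E) (n : ℕ) :
    iteratedFDeriv ℂ n G 0 (fun _ => u) = iteratedDeriv n (fun t : ℂ => G (t • u)) 0 := by
  obtain ⟨p, hp⟩ := hG
  set v : ℂ →L[ℂ] E := ContinuousLinearMap.toSpanSingleton ℂ u with hv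
  have hp' : HasFPowerSeriesAt G p (v 0) := by simpa using hp
  obtain ⟨r, hr⟩ := hp
  obtain ⟨r', hr'⟩ := hp'.compContinuousLinearMap
  have h1 := hr.factorial_smul u n
  have h2 := hr'.factorial_smul (1 : ℂ) n
  rw [← h1, iteratedDeriv_eq_iteratedFDeriv]
  refine Eq.trans ?_ h2
  rw [FormalMultilinearSeries.compContinuousLinearMap_apply]
  simp [hv, Function.comp_def]

theorem IsPhi.deriv_eq {Φ : ℂ → ℂ} (hΦ : IsPhi Φ) : deriv Φ 0 = d1 Φ :=
  Complex.ext rfl (by simpa using hΦ.deriv_im)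

theorem IsPhi.iteratedDeriv_two_eq {Φ : ℂ → ℂ} (hΦ : IsPhi Φ) : iteratedDeriv 2 Φ 0 = d2 Φ :=
  Complex.ext rfl (by simpa using hΦ.deriv2_im)

theorem IsPhi.analyticAt_zero {Φ : ℂ → ℂ} (hΦ : IsPhi Φ) : AnalyticAt ℂ Φ 0 :=
  hΦ.biholo.1 0 (mem_ball_self one_pos)

/-- The first two Taylor coefficients of a solution of `ζ h' / h = Φ ∘ ω - 1`. -/
theorem taylor_of_subordinate {Φ ω h : ℂ → ℂ} (hΦ : AnalyticAt ℂ Φ 0) (hω : AnalyticAt ℂ ω 0)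
    (hω0 : ω 0 = 0) (hh : AnalyticAt ℂ h 0) (h0 : h 0 = 1)
    (heq : ∀ᶠ ζ in 𝓝 (0 : ℂ), ζ * deriv h ζ = h ζ * (Φ (ω ζ) - 1)) :
    deriv h 0 = deriv Φ 0 * deriv ω 0 ∧
      iteratedDeriv 2 h 0 = (deriv Φ 0 ^ 2 + iteratedDeriv 2 Φ 0 / 2) * deriv ω 0 ^ 2
        + deriv Φ 0 * iteratedDeriv 2 ω 0 / 2 := by
  have hΦ' : AnalyticAt ℂ Φ (ω 0) := by rwa [hω0]
  obtain ⟨h1, h2⟩ := iteratedDeriv_of_mul_deriv_eq hh (hΦ'.comp hω) h0 heq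
  have e1 : deriv (Φ ∘ ω) 0 = deriv Φ 0 * deriv ω 0 := by
    rw [deriv_comp 0 hΦ'.differentiableAt hω.differentiableAt, hω0]
  have e2 := iteratedDeriv_comp_two (x := (0 : ℂ)) hΦ'.contDiffAt hω.contDiffAt
  rw [hω0] at e2
  refine ⟨h1.trans e1, ?_⟩
  rw [h2, e1, e2]
  ring

/-- A holomorphic function with values in `Φ(𝕌)` and the value `1` at `0` is subordinate to `Φ`. -/
theorem exists_schwarz_of_subordinate {Φ Q : ℂ → ℂ} (hΦ : IsPhi Φ)
    (hQ : AnalyticOnNhd ℂ Q (ball 0 1)) (hQ0 : Q 0 = 1)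
    (hmem : ∀ ζ ∈ ball (0 : ℂ) 1, Q ζ ∈ Φ '' ball (0 : ℂ) 1) :
    ∃ ω : ℂ → ℂ, AnalyticOnNhd ℂ ω (ball 0 1) ∧ MapsTo ω (ball 0 1) (ball 0 1) ∧ ω 0 = 0 ∧
      ∀ ζ ∈ ball (0 : ℂ) 1, Φ (ω ζ) = Q ζ := by
  obtain ⟨-, -, -, H, hH, hinv⟩ := hΦ.biholo
  refine ⟨fun ζ => H (Q ζ), ?_, ?_, ?_, ?_⟩
  · exact fun ζ hζ => (hH _ (hmem ζ hζ)).comp (hQ ζ hζ)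
  · intro ζ hζ
    obtain ⟨w, hw, hwQ⟩ := hmem ζ hζ
    simpa [← hwQ, hinv w hw] using hw
  · have := hinv 0 (mem_ball_self one_pos)
    rwa [hΦ.map_zero, ← hQ0] at this
  · intro ζ hζ
    obtain ⟨w, hw, hwQ⟩ := hmem ζ hζ
    simp only [← hwQ, hinv w hw]

/-- The extremal problem for the coefficients `a` and `c / 2` of a Schwarz function. The hypothesis on
`B = Φ' 0` and `C = Φ'' 0` says that `a²` has at least the weight of `c / 2` in the second bound,
so that both bounds are largest at `‖a‖ = 1`. -/
theorem norm_sq_sub_sq_le {B C : ℝ} (hB : 0 < B) (hC : 2 * B ≤ |C + 2 * B ^ 2|) {a c : ℂ}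
    (hc : ‖c‖ ≤ 2 * (1 - ‖a‖ ^ 2)) :
    ‖((B : ℂ) * a) ^ 2 - ((((B : ℂ) ^ 2 + C / 2) * a ^ 2 + B * c / 2) / 2) ^ 2‖ ≤
      B ^ 2 / 4 * (1 / 2 * (C / B) + B) ^ 2 + B ^ 2 := by
  have hrhs : B ^ 2 / 4 * (1 / 2 * (C / B) + B) ^ 2 + B ^ 2 =
      (|C + 2 * B ^ 2| / 4) ^ 2 + B ^ 2 := by
    rw [div_pow, sq_abs]
    field_simp
    ring
  rw [hrhs]
  set K := |C + 2 * B ^ 2| with hK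
  have hx0 : 0 ≤ ‖a‖ ^ 2 := by positivity
  have hx1 : ‖a‖ ^ 2 ≤ 1 := by linarith [norm_nonneg c]
  have hb : ‖((((B : ℂ) ^ 2 + C / 2) * a ^ 2 + B * c / 2) / 2)‖ ≤ K / 4 := by
    have h1 : ‖((B : ℂ) ^ 2 + C / 2)‖ = K / 2 := by
      rw [show ((B : ℂ) ^ 2 + C / 2) = ((C + 2 * B ^ 2 : ℝ) : ℂ) / 2 by push_cast; ring, norm_div,
        Complex.norm_real, Real.norm_eq_abs, Complex.norm_ofNat]
    calc ‖((((B : ℂ) ^ 2 + C / 2) * a ^ 2 + B * c / 2) / 2)‖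
        ≤ (K / 2 * ‖a‖ ^ 2 + B * ‖c‖ / 2) / 2 := by
          rw [norm_div, Complex.norm_ofNat]
          gcongr
          refine (norm_add_le _ _).trans_eq ?_
          rw [norm_mul, h1, norm_pow, norm_div, norm_mul, Complex.norm_real,
            Real.norm_of_nonneg hB.le, Complex.norm_ofNat]
      _ ≤ K / 4 := by nlinarith
  calc _ ≤ ‖((B : ℂ) * a) ^ 2‖ + ‖((((B : ℂ) ^ 2 + C / 2) * a ^ 2 + B * c / 2) / 2) ^ 2‖ :=
        norm_sub_le _ _
    _ ≤ B ^ 2 + (K / 4) ^ 2 := by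
        rw [norm_pow _ 2, norm_pow _ 2]
        gcongr
        rw [norm_mul, Complex.norm_real, Real.norm_of_nonneg hB.le]
        nlinarith [norm_nonneg a]
    _ = _ := by ring

/-! ### Reduction of generators to a complex line -/

variable {X : Type*} [NormedAddCommGroup X] [NormedSpace ℂ X]

theorem fderiv_mulSelf_apply {g : X → ℂ} {z : X} (hg : DifferentiableAt ℂ g z) (v : X) :
    fderiv ℂ (mulSelf g) z v = g z • v + fderiv ℂ g z v • z := by
  have := (hg.hasFDerivAt.smul (hasFDerivAt_id z)).fderiv
  change fderiv ℂ (g • id) z v = _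
  rw [this]
  simp

/-- On the line spanned by a unit vector `u`, the functional `l` turns `z g(z)` into
`ζ ↦ ζ g(ζ u)`, so its coefficients are the shifted Taylor coefficients of `ζ ↦ g(ζ u)`. -/
theorem coeff_succ_mulSelf [CompleteSpace X] {g : X → ℂ} (hg : AnalyticAt ℂ g 0) {u : X}
    {l : X →L[ℂ] ℂ} (hlu : l u = 1) (hu : ‖u‖ = 1) {r : ℝ} (hr : 0 < r) (n : ℕ) :
    coeff (n + 1) (mulSelf g) l ((r : ℂ) • u) =
      iteratedDeriv n (fun ζ : ℂ => g (ζ • u)) 0 / n.factorial := by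
  have hG : AnalyticAt ℂ (mulSelf g) 0 := hg.smul analyticAt_id
  have hline : AnalyticAt ℂ (fun ζ : ℂ => g (ζ • u)) 0 := by
    have hg' : AnalyticAt ℂ g ((0 : ℂ) • u) := by rwa [zero_smul]
    exact hg'.comp (f := fun ζ : ℂ => ζ • u) (analyticAt_id.smul analyticAt_const)
  have hlG : l (iteratedFDeriv ℂ (n + 1) (mulSelf g) 0 fun _ => u) =
      (n + 1) * iteratedDeriv n (fun ζ : ℂ => g (ζ • u)) 0 := by
    have h1 := l.iteratedFDeriv_comp_left (i := n + 1) (hG.contDiffAt (n := (n + 1 : ℕ))) le_rfl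
    have h2 := iteratedFDeriv_apply_line ((l.analyticAt (mulSelf g 0)).comp hG) u (n + 1)
    rw [h1] at h2
    refine h2.trans ?_
    rw [← iteratedDeriv_succ_id_mul n hline.contDiffAt]
    congr 1
    ext ζ
    simp [mulSelf, hlu, mul_comm]
  have hrn : ((r : ℂ)) ^ (n + 1) ≠ 0 := pow_ne_zero _ (by exact_mod_cast hr.ne')
  have hnorm : ‖(r : ℂ) • u‖ = r := by rw [norm_smul, hu, mul_one, Complex.norm_real,
    Real.norm_of_nonneg hr.le]
  have hsm := (iteratedFDeriv ℂ (n + 1) (mulSelf g) 0).map_smul_univ (fun _ => (r : ℂ)) fun _ => u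
  simp only [Finset.prod_const, Finset.card_univ, Fintype.card_fin] at hsm
  have hfac : ((n.factorial : ℕ) : ℂ) ≠ 0 := by exact_mod_cast n.factorial_ne_zero
  have hn1 : (n : ℂ) + 1 ≠ 0 := by exact_mod_cast n.succ_ne_zero
  rw [coeff, hsm, map_smul, hlG, hnorm, Nat.factorial_succ, smul_eq_mul]
  push_cast
  field_simp

/-- For a generator `g`, the logarithmic derivative of `ζ g(ζ z)` at `ζ = 1` is a value of `Φ`. The
vector `p = (DG(z))⁻¹ G(z)` is a multiple `c • z`, and `1 / c` is at once that logarithmic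
derivative and `‖z‖ / l(p)`. -/
theorem IsGenerator.exists_eq {Φ : ℂ → ℂ} (hΦ : IsPhi Φ) {g : X → ℂ} (hg : IsGenerator Φ g)
    {z : X} (hz : z ∈ ball (0 : X) 1) :
    g z ≠ 0 ∧ 1 + fderiv ℂ g z z / g z ∈ Φ '' ball (0 : ℂ) 1 := by
  by_cases hz0 : z = 0
  · subst hz0
    refine ⟨by simp [hg.map_zero], 0, mem_ball_self one_pos, by simp [hΦ.map_zero]⟩
  obtain ⟨l, hl1, hlz'⟩ := exists_dual_vector ℂ z (norm_ne_zero_iff.2 hz0)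
  have hlz : l z = (‖z‖ : ℂ) := hlz'
  have hznorm : (‖z‖ : ℂ) ≠ 0 := by exact_mod_cast norm_ne_zero_iff.2 hz0
  set p := (fderiv ℂ (mulSelf g) z).inverse (mulSelf g z) with hp
  obtain ⟨ζ, hζ, hζΦ⟩ : (‖z‖ : ℂ) / l p ∈ Φ '' ball (0 : ℂ) 1 :=
    hg.mem_classM.2.2.2 z ⟨hz, hz0⟩ l ⟨hlz, hl1⟩
  have hpos := hΦ.re_pos ζ hζ
  -- A zero denominator would make the quotient `0`, which is not in the right half-plane.
  have hne : l p ≠ 0 := by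
    intro h
    simp [hζΦ, h] at hpos
  have hDp : g z • p + fderiv ℂ g z p • z = g z • z := by
    rw [← fderiv_mulSelf_apply (hg.holo z hz).differentiableAt, hp,
      (hg.invertible z hz).self_apply_inverse]
    rfl
  have hgz : g z ≠ 0 := by
    intro h
    apply hne
    simp [hp, mulSelf, h]
  obtain ⟨c, hc⟩ : ∃ c : ℂ, p = c • z := by
    refine ⟨(g z)⁻¹ * (g z - fderiv ℂ g z p), ?_⟩
    rw [mul_smul, sub_smul, ← hDp, add_sub_cancel_right, inv_smul_smul₀ hgz]
  have hc0 : c ≠ 0 := by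
    rintro rfl
    simp [hc] at hne
  have hrel : c * (g z + fderiv ℂ g z z) = g z := by
    have := hDp
    rw [hc, map_smul, smul_smul, smul_eq_mul, ← add_smul] at this
    have := smul_left_injective ℂ hz0 this
    linear_combination this
  refine ⟨hgz, ζ, hζ, ?_⟩
  rw [hζΦ, hc, map_smul, hlz, smul_eq_mul, mul_comm c, div_mul_cancel_left₀ hznorm]
  field_simp
  linear_combination -hrel

/-- The upper bound, with `ζ ↦ g(ζ u)` on the line through `u = z / ‖z‖` in the role of `h`. -/
theorem norm_coeff_sq_sub_sq_le [CompleteSpace X] {Φ : ℂ → ℂ} (hΦ : IsPhi Φ)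
    (hcond : 2 * d1 Φ ≤ |d2 Φ + 2 * d1 Φ ^ 2|) {g : X → ℂ} (hg : IsGenerator Φ g) {z : X}
    (hz : z ≠ 0) {l : X →L[ℂ] ℂ} (hl : l ∈ supportFunctionals z) :
    ‖coeff 2 (mulSelf g) l z ^ 2 - coeff 3 (mulSelf g) l z ^ 2‖ ≤
      d1 Φ ^ 2 / 4 * (1 / 2 * (d2 Φ / d1 Φ) + d1 Φ) ^ 2 + d1 Φ ^ 2 := by
  have hball0 : (0 : ℂ) ∈ ball (0 : ℂ) 1 := mem_ball_self one_pos
  have hr : 0 < ‖z‖ := norm_pos_iff.2 hz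
  have hrc : (‖z‖ : ℂ) ≠ 0 := by exact_mod_cast hr.ne'
  obtain ⟨u, hzu⟩ : ∃ u : X, (‖z‖ : ℂ) • u = z := ⟨(‖z‖ : ℂ)⁻¹ • z, smul_inv_smul₀ hrc z⟩
  have hu : ‖u‖ = 1 := by
    have := congrArg norm hzu
    rw [norm_smul, Complex.norm_real, norm_norm] at this
    exact mul_left_cancel₀ hr.ne' (this.trans (mul_one _).symm)
  have hlu : l u = 1 := by
    have := hl.1
    rw [← hzu, map_smul, hzu, smul_eq_mul] at this
    exact mul_left_cancel₀ hrc (this.trans (mul_one _).symm)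
  have hline : ∀ ζ ∈ ball (0 : ℂ) 1, ζ • u ∈ ball (0 : X) 1 := by
    intro ζ hζ
    simpa [norm_smul, hu] using hζ
  set h : ℂ → ℂ := fun ζ => g (ζ • u) with hh
  have hhan : AnalyticOnNhd ℂ h (ball 0 1) := fun ζ hζ =>
    (hg.holo _ (hline ζ hζ)).comp (f := fun ζ : ℂ => ζ • u) (analyticAt_id.smul analyticAt_const)
  have hh0 : h 0 = 1 := by simp [hh, hg.map_zero]
  have hderiv : ∀ ζ ∈ ball (0 : ℂ) 1, ζ * deriv h ζ = fderiv ℂ g (ζ • u) (ζ • u) := by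
    intro ζ hζ
    have h1 : HasDerivAt (fun t : ℂ => t • u) u ζ := by
      simpa using (hasDerivAt_id ζ).smul_const u
    have h2 := ((hg.holo _ (hline ζ hζ)).differentiableAt.hasFDerivAt.comp_hasDerivAt ζ h1).deriv
    rw [map_smul, smul_eq_mul]
    exact congrArg (ζ * ·) h2
  have hne : ∀ ζ ∈ ball (0 : ℂ) 1, h ζ ≠ 0 := fun ζ hζ => (hg.exists_eq hΦ (hline ζ hζ)).1
  obtain ⟨ω, hωan, hωm, hω0, hωQ⟩ := exists_schwarz_of_subordinate hΦ
    (Q := fun ζ => 1 + ζ * deriv h ζ / h ζ)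
    (fun ζ hζ => analyticAt_const.add
      ((analyticAt_id.mul (hhan ζ hζ).deriv).div (hhan ζ hζ) (hne ζ hζ)))
    (by simp)
    (fun ζ hζ => by
      simp only [hderiv ζ hζ]
      exact (hg.exists_eq hΦ (hline ζ hζ)).2)
  obtain ⟨t1, t2⟩ := taylor_of_subordinate hΦ.analyticAt_zero (hωan 0 hball0) hω0 (hhan 0 hball0)
    hh0 (by
      filter_upwards [ball_mem_nhds (0 : ℂ) one_pos] with ζ hζ
      rw [hωQ ζ hζ]
      field_simp [hne ζ hζ]
      ring)
  have hg0 : AnalyticAt ℂ g 0 := hg.holo 0 (mem_ball_self one_pos)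
  have c2 := coeff_succ_mulSelf hg0 hlu hu hr 1
  have c3 := coeff_succ_mulSelf hg0 hlu hu hr 2
  rw [iteratedDeriv_one] at c2
  rw [hzu] at c2 c3
  rw [c2, c3, ← hh, t1, t2, hΦ.deriv_eq, hΦ.iteratedDeriv_two_eq]
  have hpos : 0 < d1 Φ := hΦ.deriv_pos
  simpa using norm_sq_sub_sq_le hpos hcond
    (norm_iteratedDeriv_two_le hωan.differentiableOn hωm hω0)

/-! ### Extremal generators -/

/-- The solution `h = exp ∫ (F - 1) / ζ` of `ζ h' = h (F - 1)` on the disk. -/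
theorem exists_extremal_function {F : ℂ → ℂ} (hF : DifferentiableOn ℂ F (ball 0 1))
    (hF0 : F 0 = 1) :
    ∃ h : ℂ → ℂ, AnalyticOnNhd ℂ h (ball 0 1) ∧ h 0 = 1 ∧ (∀ ζ, h ζ ≠ 0) ∧
      ∀ ζ ∈ ball (0 : ℂ) 1, ζ * deriv h ζ = h ζ * (F ζ - 1) := by
  have hs : DifferentiableOn ℂ (dslope F 0) (ball 0 1) :=
    (Complex.differentiableOn_dslope (ball_mem_nhds _ one_pos)).2 hF
  obtain ⟨P, hP0, hP⟩ := hs.isExactOn_ball.with_val_at 0 0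
  have hd : ∀ ζ ∈ ball (0 : ℂ) 1, HasDerivAt (fun ζ => Complex.exp (P ζ))
      (Complex.exp (P ζ) * dslope F 0 ζ) ζ := fun ζ hζ => (hP ζ hζ).cexp
  refine ⟨fun ζ => Complex.exp (P ζ), ?_, by simp [hP0], fun ζ => Complex.exp_ne_zero _, ?_⟩
  · exact DifferentiableOn.analyticOnNhd
      (fun ζ hζ => (hd ζ hζ).differentiableAt.differentiableWithinAt) isOpen_ball
  · intro ζ hζ
    have hslope := sub_smul_dslope F 0 ζ
    rw [sub_zero, smul_eq_mul, hF0] at hslope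
    rw [(hd ζ hζ).deriv, ← hslope]
    ring

/-- A rank-one perturbation of a multiple of the identity is inverted by the Sherman–Morrison
formula. -/
theorem isInvertible_smul_id_add_smulRight {a : ℂ} {D : X →L[ℂ] ℂ} {z : X} (ha : a ≠ 0)
    (hD : a + D z ≠ 0) :
    (a • ContinuousLinearMap.id ℂ X + D.smulRight z).IsInvertible := by
  refine ContinuousLinearMap.IsInvertible.of_inverse
    (g := a⁻¹ • (ContinuousLinearMap.id ℂ X - (a + D z)⁻¹ • D.smulRight z)) ?_ ?_
  · ext v
    simp only [ContinuousLinearMap.comp_apply, _root_.add_apply,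
      _root_.smul_apply, _root_.sub_apply, ContinuousLinearMap.id_apply,
      ContinuousLinearMap.smulRight_apply, map_smul, map_sub]
    match_scalars <;> field_simp
    ring
  · ext v
    simp only [ContinuousLinearMap.comp_apply, _root_.add_apply,
      _root_.smul_apply, _root_.sub_apply, ContinuousLinearMap.id_apply,
      ContinuousLinearMap.smulRight_apply, map_smul, map_add]
    match_scalars <;> field_simp
    ring

/-- A one-variable solution of `ζ h' / h = F - 1`, with `F` subordinate to `Φ`, gives the generator
`h ∘ m`, for which `(DG(z))⁻¹ G(z) = z / F (m z)`. -/
theorem isGenerator_comp_functional {Φ F h : ℂ → ℂ} (hΦ : IsPhi Φ)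
    (hF : AnalyticOnNhd ℂ F (ball 0 1)) (hF0 : F 0 = 1)
    (hmem : ∀ ζ ∈ ball (0 : ℂ) 1, F ζ ∈ Φ '' ball (0 : ℂ) 1)
    (hh : AnalyticOnNhd ℂ h (ball 0 1)) (h0 : h 0 = 1) (hne : ∀ ζ, h ζ ≠ 0)
    (heq : ∀ ζ ∈ ball (0 : ℂ) 1, ζ * deriv h ζ = h ζ * (F ζ - 1)) {m : X →L[ℂ] ℂ}
    (hm : ‖m‖ ≤ 1) : IsGenerator Φ fun z => h (m z) := by
  have hmz : ∀ z ∈ ball (0 : X) 1, m z ∈ ball (0 : ℂ) 1 := by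
    intro z hz
    rw [mem_ball_zero_iff] at hz ⊢
    exact (m.le_of_opNorm_le hm z).trans_lt (by rwa [one_mul])
  have hcomp : ∀ {f : ℂ → ℂ}, AnalyticOnNhd ℂ f (ball 0 1) →
      ∀ z ∈ ball (0 : X) 1, AnalyticAt ℂ (fun y => f (m y)) z := fun hf z hz =>
    (hf _ (hmz z hz)).comp (m.analyticAt z)
  have hFne : ∀ ζ ∈ ball (0 : ℂ) 1, F ζ ≠ 0 := by
    intro ζ hζ hzero
    obtain ⟨w, hw, hwF⟩ := hmem ζ hζ
    have := hΦ.re_pos w hw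
    simp [hwF, hzero] at this
  set g : X → ℂ := fun z => h (m z) with hg
  have hrad : ∀ z ∈ ball (0 : X) 1, g z + fderiv ℂ g z z = g z * F (m z) := by
    intro z hz
    have h1 : fderiv ℂ g z z = m z * deriv h (m z) := by
      have := ((hh _ (hmz z hz)).differentiableAt.hasDerivAt.comp_hasFDerivAt z
        m.hasFDerivAt).fderiv
      change fderiv ℂ (h ∘ m) z z = _
      rw [this]
      simp [mul_comm]
    rw [h1, heq _ (hmz z hz)]
    ring
  have hfd : ∀ z ∈ ball (0 : X) 1, fderiv ℂ (mulSelf g) z =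
      g z • ContinuousLinearMap.id ℂ X + (fderiv ℂ g z).smulRight z := by
    intro z hz
    ext v
    simpa using fderiv_mulSelf_apply (hcomp hh z hz).differentiableAt v
  have hinv : ∀ z ∈ ball (0 : X) 1, (fderiv ℂ (mulSelf g) z).IsInvertible := by
    intro z hz
    rw [hfd z hz]
    exact isInvertible_smul_id_add_smulRight (hne _)
      (by rw [hrad z hz]; exact mul_ne_zero (hne _) (hFne _ (hmz z hz)))
  have hp : ∀ z ∈ ball (0 : X) 1,
      (fderiv ℂ (mulSelf g) z).inverse (mulSelf g z) = mulSelf (fun y => (F (m y))⁻¹) z := by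
    intro z hz
    rw [(hinv z hz).inverse_apply_eq, mulSelf, mulSelf, map_smul,
      fderiv_mulSelf_apply (hcomp hh z hz).differentiableAt, ← add_smul, hrad z hz, smul_smul]
    congr 1
    field_simp [hFne _ (hmz z hz)]
  have hkan : ∀ z ∈ ball (0 : X) 1, AnalyticAt ℂ (fun y => (F (m y))⁻¹) z := fun z hz =>
    (hcomp hF z hz).inv (hFne _ (hmz z hz))
  have hev : ∀ z ∈ ball (0 : X) 1,
      (fun z => (fderiv ℂ (mulSelf g) z).inverse (mulSelf g z)) =ᶠ[𝓝 z]
        mulSelf (fun y => (F (m y))⁻¹) := fun z hz => by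
    filter_upwards [isOpen_ball.mem_nhds hz] using hp
  have hz0 : (0 : X) ∈ ball (0 : X) 1 := mem_ball_self one_pos
  refine ⟨hcomp hh, by simp [hg, h0], hinv, ?_, ?_, ?_, ?_⟩
  · intro z hz
    exact ((hkan z hz).smul analyticAt_id).congr (hev z hz).symm
  · simp [mulSelf]
  · rw [(hev 0 hz0).fderiv_eq]
    ext v
    rw [fderiv_mulSelf_apply (hkan 0 hz0).differentiableAt]
    simp [hF0]
  · rintro z ⟨hz, hzne⟩ l ⟨hlz, -⟩
    have hznorm : (‖z‖ : ℂ) ≠ 0 := by exact_mod_cast norm_ne_zero_iff.2 hzne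
    simp only [hp z hz]
    rw [mulSelf, map_smul, hlz, smul_eq_mul, mul_comm, div_mul_cancel_left₀ hznorm, inv_inv]
    exact hmem _ (hmz z hz)

/-- Sharpness: for the Schwarz function `ω ζ = i ζ` and `g = h ∘ m` with `m` a support functional of
`u`, the factor `i` makes `b₂²` negative and `b₃²` nonnegative, so the triangle inequality is an
equality. -/
theorem exists_isGenerator_eq [CompleteSpace X] {Φ : ℂ → ℂ} (hΦ : IsPhi Φ) {u : X}
    (hu : ‖u‖ = 1) :
    ∃ g : X → ℂ, IsGenerator Φ g ∧
      ∀ r : ℝ, 0 < r → ∀ l ∈ supportFunctionals ((r : ℂ) • u),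
        ‖coeff 2 (mulSelf g) l ((r : ℂ) • u) ^ 2 - coeff 3 (mulSelf g) l ((r : ℂ) • u) ^ 2‖ =
          d1 Φ ^ 2 / 4 * (1 / 2 * (d2 Φ / d1 Φ) + d1 Φ) ^ 2 + d1 Φ ^ 2 := by
  have hball0 : (0 : ℂ) ∈ ball (0 : ℂ) 1 := mem_ball_self one_pos
  have hrot : ∀ ζ ∈ ball (0 : ℂ) 1, Complex.I * ζ ∈ ball (0 : ℂ) 1 := by
    intro ζ hζ
    simpa using hζ
  have hωan : AnalyticOnNhd ℂ (fun ζ => Complex.I * ζ) (ball 0 1) := fun ζ _ =>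
    analyticAt_const.mul analyticAt_id
  have hFan : AnalyticOnNhd ℂ (fun ζ => Φ (Complex.I * ζ)) (ball 0 1) := fun ζ hζ =>
    (hΦ.biholo.1 _ (hrot ζ hζ)).comp (f := fun ζ => Complex.I * ζ) (hωan ζ hζ)
  obtain ⟨h, hh, h0, hne, heq⟩ := exists_extremal_function hFan.differentiableOn
    (by simp [hΦ.map_zero])
  obtain ⟨m, hm, hmu⟩ := exists_dual_vector ℂ u (by simp [hu])
  have hmu1 : m u = 1 := by simpa [hu] using hmu
  have hg := isGenerator_comp_functional hΦ hFan (by simp [hΦ.map_zero])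
    (fun ζ hζ => ⟨_, hrot ζ hζ, rfl⟩) hh h0 hne heq hm.le
  refine ⟨_, hg, ?_⟩
  rintro r hr l ⟨hl, -⟩
  have hlu : l u = 1 := by
    rw [map_smul, norm_smul, hu, mul_one, Complex.norm_real, Real.norm_of_nonneg hr.le,
      smul_eq_mul] at hl
    exact mul_left_cancel₀ (by exact_mod_cast hr.ne') (hl.trans (mul_one _).symm)
  obtain ⟨t1, t2⟩ := taylor_of_subordinate (ω := fun ζ => Complex.I * ζ) hΦ.analyticAt_zero
    (hωan 0 hball0) (by simp) (hh 0 hball0) h0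
    (by filter_upwards [ball_mem_nhds (0 : ℂ) one_pos] using heq)
  have hω1 : deriv (fun ζ => Complex.I * ζ) = fun _ => Complex.I := by
    ext ζ
    simp
  have hω2 : iteratedDeriv 2 (fun ζ => Complex.I * ζ) 0 = 0 := by
    rw [iteratedDeriv_succ', hω1, iteratedDeriv_one, deriv_const]
  have hg0 : AnalyticAt ℂ (fun z => h (m z)) 0 := hg.holo 0 (mem_ball_self one_pos)
  have c2 := coeff_succ_mulSelf hg0 hlu hu hr 1
  have c3 := coeff_succ_mulSelf hg0 hlu hu hr 2
  simp only [map_smul, hmu1, smul_eq_mul, mul_one] at c2 c3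
  rw [iteratedDeriv_one] at c2
  rw [c2, c3, t1, t2, hω1, hω2, hΦ.deriv_eq, hΦ.iteratedDeriv_two_eq]
  have hB : 0 < d1 Φ := hΦ.deriv_pos
  have hBc : (d1 Φ : ℂ) ≠ 0 := by exact_mod_cast hB.ne'
  have hval : ((d1 Φ : ℂ) * Complex.I / (Nat.factorial 1 : ℕ)) ^ 2 -
      ((((d1 Φ : ℂ) ^ 2 + d2 Φ / 2) * Complex.I ^ 2 + d1 Φ * 0 / 2) / (Nat.factorial 2 : ℕ)) ^ 2 =
      ((-(d1 Φ ^ 2 / 4 * (1 / 2 * (d2 Φ / d1 Φ) + d1 Φ) ^ 2 + d1 Φ ^ 2) : ℝ) : ℂ) := by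
    push_cast
    rw [mul_div_assoc, mul_pow, div_pow, Complex.I_sq]
    simp only [Nat.factorial]
    push_cast
    field_simp
    ring
  rw [hval, Complex.norm_real, norm_neg, Real.norm_of_nonneg (by positivity)]

end Toeplitz

theorem theorem3 {X : Type*} [NormedAddCommGroup X] [NormedSpace ℂ X] [CompleteSpace X]
    (Φ : ℂ → ℂ) (hΦ : Toeplitz.IsPhi Φ)
    (hcond : 2 * Toeplitz.d1 Φ ≤ |Toeplitz.d2 Φ + 2 * Toeplitz.d1 Φ ^ 2|) :
    (∀ g : X → ℂ, Toeplitz.IsGenerator Φ g →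
      ∀ z ∈ Metric.ball (0 : X) 1 \ {0}, ∀ l ∈ Toeplitz.supportFunctionals z,
        ‖Toeplitz.coeff 2 (Toeplitz.mulSelf g) l z ^ 2
            - Toeplitz.coeff 3 (Toeplitz.mulSelf g) l z ^ 2‖ ≤
          Toeplitz.d1 Φ ^ 2 / 4 *
              (1 / 2 * (Toeplitz.d2 Φ / Toeplitz.d1 Φ) + Toeplitz.d1 Φ) ^ 2
            + Toeplitz.d1 Φ ^ 2) ∧
    (∀ u : X, ‖u‖ = 1 → ∃ g : X → ℂ, Toeplitz.IsGenerator Φ g ∧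
      ∀ r : ℝ, 0 < r → r < 1 → ∀ l ∈ Toeplitz.supportFunctionals ((r : ℂ) • u),
        ‖Toeplitz.coeff 2 (Toeplitz.mulSelf g) l ((r : ℂ) • u) ^ 2
            - Toeplitz.coeff 3 (Toeplitz.mulSelf g) l ((r : ℂ) • u) ^ 2‖ =
          Toeplitz.d1 Φ ^ 2 / 4 *
              (1 / 2 * (Toeplitz.d2 Φ / Toeplitz.d1 Φ) + Toeplitz.d1 Φ) ^ 2
            + Toeplitz.d1 Φ ^ 2) := by
  exact ⟨fun g hg z hz l hl => Toeplitz.norm_coeff_sq_sub_sq_le hΦ hcond hg hz.2 hl,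
    fun u hu => (Toeplitz.exists_isGenerator_eq hΦ hu).imp fun g hg =>
      ⟨hg.1, fun r hr _ => hg.2 r hr⟩⟩
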